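/- Let $q\in(0,1)$, let $a,b\in\mathbb{R}$ with $0<|a|<1$, $|b|<1$ and $qb/a\notin\{q^{-k}: k=0,1,2,\dots\}$, and let $\theta\in(0,\pi)$. Write $(c;q)_n=\prod_{j=0}^{n-1}(1-cq^j)$ for $n\in\mathbb{N}_0\cup\{\infty\}$ and $(c_1,\dots,c_r;q)_n=(c_1;q)_n\cdots(c_r;q)_n$, and let $${}_0\phi_1(-;c;q;z)=\sum_{m=0}^{\infty}\frac{q^{m(m-1)}z^m}{(c;q)_m(q;q)_m}.$$ Let $Q_n(x;a,b\,|\,q)$ be the Al-Salam--Chihara polynomials, determined by $Q_{-1}=0$, $Q_0=1$ and $$(1-q^{n})(1-abq^{n-1})Q_{n-1}+\left((a+b)q^{n}-2x\right)Q_{n}+Q_{n+1}=0,\qquad n\ge 0.$$ Then $$\sum_{n=0}^{\infty}\frac{(-a)^n q^{n(n-1)/2}}{(q,ab;q)_n}\;{}_0\phi_1\!\left(-;\frac{qb}{a};q;\frac{q^{2-n}}{a^2}\right)Q_n(\cos\theta;a,b\,|\,q)=\frac{(ae^{-i\theta},\,ae^{i\theta},\,qe^{-i\theta}/a,\,qe^{i\theta}/a;q)_\infty}{(ab,\,qb/a;q)_\infty},$$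 where the series over $n$, as well as each series defining a value of ${}_0\phi_1$ in it, converges absolutely. -/

import Mathlib

/-- The finite `q`-Pochhammer symbol `(a;q)_n = ∏_{j<n} (1 - a q^j)`. -/
noncomputable def qPochhammer (a q : ℂ) (n : ℕ) : ℂ :=
  ∏ j ∈ Finset.range n, (1 - a * q ^ j)

/-- The infinite `q`-Pochhammer symbol `(a;q)_∞ = ∏_{j≥0} (1 - a q^j)`, for `|q| < 1`. -/
noncomputable def qPochhammerInf (a q : ℂ) : ℂ :=
  ∏' j : ℕ, (1 - a * q ^ j)

/-- For `|q| < 1` the product defining `(a;q)_∞` converges. -/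
theorem hasProd_qPochhammerInf (a : ℂ) {q : ℂ} (hq : ‖q‖ < 1) :
    HasProd (fun j : ℕ => 1 - a * q ^ j) (qPochhammerInf a q) := by
  have hs : Summable (fun j : ℕ => ‖-(a * q ^ j)‖) := by
    simpa [norm_mul, norm_pow] using
      (summable_geometric_of_lt_one (norm_nonneg q) hq).mul_left ‖a‖
  have hm : Multipliable (fun j : ℕ => 1 + -(a * q ^ j)) :=
    multipliable_one_add_of_summable hs
  simpa only [qPochhammerInf, sub_eq_add_neg] using hm.hasProd

/-- The `n`-th term of the basic hypergeometric series
`_rφ_s(a₁,…,a_r; b₁,…,b_s; q; z)`. -/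
noncomputable def basicHypergeometricTerm (as bs : List ℂ) (q z : ℂ) (n : ℕ) : ℂ :=
  (as.map fun c => qPochhammer c q n).prod / (bs.map fun c => qPochhammer c q n).prod *
    ((-1) ^ n * q ^ (n * (n - 1) / 2)) ^ (1 + (bs.length : ℤ) - (as.length : ℤ)) *
    (z ^ n / qPochhammer q q n)

/-- The basic hypergeometric series `_rφ_s(a₁,…,a_r; b₁,…,b_s; q; z)`. -/
noncomputable def basicHypergeometric (as bs : List ℂ) (q z : ℂ) : ℂ :=
  ∑' n : ℕ, basicHypergeometricTerm as bs q z n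

/-- The Al-Salam--Chihara polynomials `Q_n(x; a, b | q)`, given by `Q_{-1} = 0`, `Q_0 = 1` and
`(1 - q^n)(1 - a b q^{n-1}) Q_{n-1} + ((a + b) q^n - 2x) Q_n + Q_{n+1} = 0`. -/
noncomputable def alSalamChihara (a b q x : ℝ) : ℕ → ℝ
  | 0 => 1
  | 1 => 2 * x - (a + b)
  | n + 2 =>
      (2 * x - (a + b) * q ^ (n + 1)) * alSalamChihara a b q x (n + 1) -
        (1 - q ^ (n + 1)) * (1 - a * b * q ^ n) * alSalamChihara a b q x n

/-!
Write `z = exp (iθ)`. The double series over `n` and the summation index `m` of `₀φ₁` converges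
absolutely, since its terms are geometric times `q^(n²/2 + m² - nm)` and this quadratic form is
positive definite (`summable_gaussian_prod`). So the sum over `n` may be carried out first. For fixed
`m` it is the generating function `∑ (-a)^n q^(n(n-1)/2) t^n Q_n / (q, ab; q)_n` at `t = q⁻ᵐ`.

This generating function is evaluated for every `m` in `hasSum_ascConvolution_mul_inv_pow`:
`Q_n / (q; q)_n` is the convolution of two sequences given by the `q`-binomial theorem
(`alSalamChihara_eq`), and in the resulting double series one summation is a `₁φ₁` with argument
`q⁻ᵐ D`, the other a `₁φ₁` with `A = 0`, that is, Euler's expansion of `(D; q)_∞`. The first reduces to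
`₁φ₁(A; AD; q, D) = (D; q)_∞ / (AD; q)_∞` by expanding `q⁻ᵐᵏ` with a terminating `q`-Chu–Vandermonde
sum (`hasSum_onePhiOneTerm`, `hasSum_onePhiOneTerm_mul_inv_pow`), and leaves a finite sum over
`i ≤ m`.

That finite sum is a multiple of `Q_m(x; q/a, b | q)` (`sum_eq_ascConvolution_dual`). Hence the
remaining series over `m` is again the same generating function, now with `q/a` in place of `a` and
at `t = 1`, where its value is a product. No bound on `|q/a|` is needed, because all the series
involved converge for arbitrary parameters; multiplying by `(αb; q)_∞` also keeps them free of
denominators depending on the parameters.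
-/

open Filter Topology

/-! ### Finite and infinite `q`-Pochhammer symbols -/

theorem qPochhammer_zero_right (x q : ℂ) : qPochhammer x q 0 = 1 := by simp [qPochhammer]

theorem qPochhammer_zero_left (q : ℂ) (n : ℕ) : qPochhammer 0 q n = 1 := by simp [qPochhammer]

theorem qPochhammer_succ (x q : ℂ) (n : ℕ) :
    qPochhammer x q (n + 1) = qPochhammer x q n * (1 - x * q ^ n) := by
  simp [qPochhammer, Finset.prod_range_succ]

theorem qPochhammer_add (x q : ℂ) (m n : ℕ) :
    qPochhammer x q (m + n) = qPochhammer x q m * qPochhammer (x * q ^ m) q n := by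
  simp only [qPochhammer, Finset.prod_range_add, pow_add, mul_assoc]

theorem qPochhammer_succ' (x q : ℂ) (n : ℕ) :
    qPochhammer x q (n + 1) = (1 - x) * qPochhammer (x * q) q n := by
  rw [add_comm, qPochhammer_add]; simp [qPochhammer]

theorem qPochhammer_ne_zero {x q : ℂ} (h : ∀ k : ℕ, x * q ^ k ≠ 1) (n : ℕ) :
    qPochhammer x q n ≠ 0 :=
  Finset.prod_ne_zero_iff.2 fun k _ => sub_ne_zero.2 (h k).symm

theorem mul_pow_ne_one_of_norm_lt_one {x q : ℂ} (hx : ‖x‖ < 1) (hq : ‖q‖ < 1) (k : ℕ) :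
    x * q ^ k ≠ 1 := by
  intro h
  have h1 : ‖x‖ * ‖q‖ ^ k = 1 := by rw [← norm_pow, ← norm_mul, h, norm_one]
  have h2 : ‖q‖ ^ k ≤ 1 := pow_le_one₀ (norm_nonneg _) hq.le
  nlinarith [norm_nonneg x]

theorem qPochhammer_self_ne_zero {q : ℂ} (hq : ‖q‖ < 1) (n : ℕ) : qPochhammer q q n ≠ 0 :=
  qPochhammer_ne_zero (mul_pow_ne_one_of_norm_lt_one hq hq) n

theorem qPochhammerInf_eq_mul (x : ℂ) {q : ℂ} (hq : ‖q‖ < 1) (n : ℕ) :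
    qPochhammerInf x q = qPochhammer x q n * qPochhammerInf (x * q ^ n) q := by
  have h1 := (hasProd_qPochhammerInf x hq).tendsto_prod_nat
  have h2 := (hasProd_qPochhammerInf (x * q ^ n) hq).tendsto_prod_nat
  refine tendsto_nhds_unique ((tendsto_add_atTop_iff_nat n).2 h1) ?_
  refine (h2.const_mul (qPochhammer x q n)).congr fun N => ?_
  have := qPochhammer_add x q n N
  rw [add_comm] at this
  simpa [qPochhammer] using this.symm

theorem qPochhammerInf_zero_left (q : ℂ) : qPochhammerInf 0 q = 1 := by simp [qPochhammerInf]

theorem qPochhammerInf_ne_zero {x q : ℂ} (hq : ‖q‖ < 1) (h : ∀ k : ℕ, x * q ^ k ≠ 1) :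
    qPochhammerInf x q ≠ 0 := by
  have := tprod_one_add_ne_zero_of_summable (f := fun j : ℕ => -(x * q ^ j))
    (fun j => by simpa [← sub_eq_add_neg, sub_eq_zero] using (h j).symm)
    (by simpa [norm_mul, norm_pow] using
      (summable_geometric_of_lt_one (norm_nonneg q) hq).mul_left ‖x‖)
  simpa only [qPochhammerInf, sub_eq_add_neg] using this

theorem norm_qPochhammerInf_sub_one_le (x : ℂ) {q : ℂ} (hq : ‖q‖ < 1) :
    ‖qPochhammerInf x q - 1‖ ≤ Real.exp (‖x‖ * (1 - ‖q‖)⁻¹) - 1 := by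
  have h1 := (hasProd_qPochhammerInf x hq).tendsto_prod_nat
  refine le_of_tendsto' (h1.sub_const 1).norm fun n => ?_
  have h2 := (Finset.range n).norm_prod_one_add_sub_one_le (fun j : ℕ => -(x * q ^ j))
  simp only [← sub_eq_add_neg] at h2
  refine h2.trans (sub_le_sub_right (Real.exp_le_exp.2 ?_) 1)
  simp only [norm_neg, norm_mul, norm_pow, ← Finset.mul_sum]
  refine mul_le_mul_of_nonneg_left ?_ (norm_nonneg x)
  rw [← tsum_geometric_of_lt_one (norm_nonneg q) hq]
  exact (summable_geometric_of_lt_one (norm_nonneg q) hq).sum_le_tsum _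
    fun _ _ => pow_nonneg (norm_nonneg q) _

theorem norm_qPochhammerInf_le (x : ℂ) {q : ℂ} (hq : ‖q‖ < 1) :
    ‖qPochhammerInf x q‖ ≤ Real.exp (‖x‖ * (1 - ‖q‖)⁻¹) := by
  have h1 := norm_qPochhammerInf_sub_one_le x hq
  have h2 := norm_add_le (qPochhammerInf x q - 1) 1
  simp only [sub_add_cancel, norm_one] at h2
  linarith

/-- The symbols `(x q^n; q)_∞` are bounded in `n`, by the bound for `(x; q)_∞`. -/
theorem norm_qPochhammerInf_mul_pow_le (x : ℂ) {q : ℂ} (hq : ‖q‖ < 1) (n : ℕ) :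
    ‖qPochhammerInf (x * q ^ n) q‖ ≤ Real.exp (‖x‖ * (1 - ‖q‖)⁻¹) := by
  refine (norm_qPochhammerInf_le _ hq).trans (Real.exp_le_exp.2 ?_)
  refine mul_le_mul_of_nonneg_right ?_ (inv_nonneg.2 (by linarith))
  rw [norm_mul, norm_pow]
  exact mul_le_of_le_one_right (norm_nonneg _) (pow_le_one₀ (norm_nonneg _) hq.le)

theorem tendsto_qPochhammerInf_mul_pow (x : ℂ) {q : ℂ} (hq : ‖q‖ < 1) :
    Tendsto (fun n : ℕ => qPochhammerInf (x * q ^ n) q) atTop (𝓝 1) := by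
  rw [tendsto_iff_norm_sub_tendsto_zero]
  refine squeeze_zero (fun _ => norm_nonneg _)
    (fun n => norm_qPochhammerInf_sub_one_le (x * q ^ n) hq) ?_
  have h1 : Tendsto (fun n : ℕ => x * q ^ n) atTop (𝓝 (x * 0)) :=
    (tendsto_pow_atTop_nhds_zero_of_norm_lt_one hq).const_mul x
  have h2 : Tendsto (fun n : ℕ => Real.exp (‖x * q ^ n‖ * (1 - ‖q‖)⁻¹) - 1) atTop
      (𝓝 (Real.exp (‖x * 0‖ * (1 - ‖q‖)⁻¹) - 1)) :=
    ((Real.continuous_exp.tendsto _).comp (h1.norm.mul_const _)).sub_const 1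
  simpa using h2

theorem norm_qPochhammer_le (x : ℂ) {q : ℂ} (hq : ‖q‖ < 1) (n : ℕ) :
    ‖qPochhammer x q n‖ ≤ (1 + ‖x‖) ^ n := by
  rw [qPochhammer, norm_prod]
  refine (Finset.prod_le_prod (fun _ _ => norm_nonneg _) (g := fun _ => 1 + ‖x‖) fun j _ => ?_).trans
    (by simp)
  refine (norm_sub_le _ _).trans ?_
  rw [norm_one, norm_mul, norm_pow]
  have := mul_le_of_le_one_right (norm_nonneg x) (pow_le_one₀ (n := j) (norm_nonneg _) hq.le)
  linarith

theorem norm_inv_qPochhammer_self_le {q : ℂ} (hq : ‖q‖ < 1) (n : ℕ) :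
    ‖(qPochhammer q q n)⁻¹‖ ≤ (1 - ‖q‖)⁻¹ ^ n := by
  rw [norm_inv, inv_pow]
  refine inv_anti₀ (pow_pos (by linarith) n) ?_
  rw [qPochhammer, norm_prod]
  refine (by simp : (1 - ‖q‖) ^ n ≤ ∏ _j ∈ Finset.range n, (1 - ‖q‖)).trans
    (Finset.prod_le_prod (fun _ _ => by linarith) fun j _ => ?_)
  have h := norm_sub_norm_le 1 (q * q ^ j)
  rw [norm_one, norm_mul, norm_pow] at h
  have := mul_le_of_le_one_right (norm_nonneg q) (pow_le_one₀ (n := j) (norm_nonneg _) hq.le)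
  linarith

/-- `1 / (x; q)_n` is bounded in `n` when no factor vanishes. -/
theorem norm_inv_qPochhammer_le {x q : ℂ} (hq : ‖q‖ < 1) (h : ∀ k : ℕ, x * q ^ k ≠ 1) (n : ℕ) :
    ‖(qPochhammer x q n)⁻¹‖ ≤ Real.exp (‖x‖ * (1 - ‖q‖)⁻¹) / ‖qPochhammerInf x q‖ := by
  have h0 := qPochhammerInf_ne_zero hq h
  have h1 : (qPochhammer x q n)⁻¹ = qPochhammerInf (x * q ^ n) q / qPochhammerInf x q := by
    have h2 := qPochhammerInf_eq_mul x hq n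
    have h3 := qPochhammer_ne_zero h n
    field_simp
    exact h2
  rw [h1, norm_div]
  gcongr
  exact norm_qPochhammerInf_mul_pow_le x hq n

/-! ### Summability of geometric times Gaussian terms -/

theorem succ_choose_two (n : ℕ) : (n + 1).choose 2 = n.choose 2 + n := by
  rw [Nat.choose_succ_succ' n 1, Nat.choose_one_right, add_comm]

theorem add_choose_two (m n : ℕ) : (m + n).choose 2 = m.choose 2 + n.choose 2 + m * n := by
  induction n with
  | zero => simp
  | succ n ih => rw [← add_assoc, succ_choose_two, succ_choose_two, ih]; ring

theorem summable_pow_mul_pow_choose_two (R : ℝ) {r : ℝ} (h0 : 0 ≤ r) (h1 : r < 1) :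
    Summable fun n : ℕ => R ^ n * r ^ n.choose 2 := by
  refine summable_of_ratio_norm_eventually_le (r := 1 / 2) (by norm_num) ?_
  have h : Tendsto (fun n : ℕ => |R| * r ^ n) atTop (𝓝 (|R| * 0)) :=
    (tendsto_pow_atTop_nhds_zero_of_lt_one h0 h1).const_mul _
  rw [mul_zero] at h
  filter_upwards [h.eventually_le_const (by norm_num : (0 : ℝ) < 1 / 2)] with n hn
  rw [succ_choose_two, pow_succ, pow_add]
  calc ‖R ^ n * R * (r ^ n.choose 2 * r ^ n)‖
      = (|R| * r ^ n) * ‖R ^ n * r ^ n.choose 2‖ := by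
        simp only [norm_mul, norm_pow, Real.norm_eq_abs, abs_of_nonneg h0]; ring
    _ ≤ _ := mul_le_mul_of_nonneg_right hn (norm_nonneg _)

/-! ### The `₁φ₁` summation and its terminating extension -/

theorem norm_mul_pow_div_le (A y : ℂ) {q : ℂ} (hq : ‖q‖ < 1) (k : ℕ) :
    ‖qPochhammer A q k * y ^ k / qPochhammer q q k‖ ≤
      ((1 + ‖A‖) * ‖y‖ * (1 - ‖q‖)⁻¹) ^ k := by
  rw [div_eq_mul_inv, norm_mul, norm_mul, norm_pow, mul_pow, mul_pow]
  exact mul_le_mul (mul_le_mul_of_nonneg_right (norm_qPochhammer_le A hq k) (by positivity))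
    (norm_inv_qPochhammer_self_le hq k) (norm_nonneg _) (by positivity)

/-- The terms of `(AD; q)_∞ · ₁φ₁(A; AD; q, D)`. Multiplying through by `(AD; q)_∞` leaves no
denominator that depends on `A` or `D`. -/
noncomputable def onePhiOneTerm (A D q : ℂ) (k : ℕ) : ℂ :=
  qPochhammer A q k * (-D) ^ k / qPochhammer q q k * q ^ k.choose 2 *
    qPochhammerInf (A * D * q ^ k) q

theorem norm_onePhiOneTerm_le (A D : ℂ) {q : ℂ} (hq : ‖q‖ < 1) (k : ℕ) :
    ‖onePhiOneTerm A D q k‖ ≤ ((1 + ‖A‖) * ‖D‖ * (1 - ‖q‖)⁻¹) ^ k * ‖q‖ ^ k.choose 2 *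
      Real.exp (‖A * D‖ * (1 - ‖q‖)⁻¹) := by
  have h1 := norm_mul_pow_div_le A (-D) hq k
  rw [norm_neg] at h1
  rw [onePhiOneTerm, norm_mul, norm_mul, norm_pow]
  have := sub_pos.2 hq
  gcongr
  exact norm_qPochhammerInf_mul_pow_le _ hq k

theorem summable_onePhiOneTerm (A D : ℂ) {q : ℂ} (hq : ‖q‖ < 1) :
    Summable (onePhiOneTerm A D q) :=
  .of_norm_bounded ((summable_pow_mul_pow_choose_two _ (norm_nonneg q) hq).mul_right _)
    (norm_onePhiOneTerm_le A D hq)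

/-- The contiguous relation behind the `₁φ₁` summation: the difference of the two sides is the
telescoping series with terms `R_k - R_{k+1}`, `R_k = (1 - q^k) t_k`, where `t_k` is the term on
the left. -/
theorem tsum_onePhiOneTerm_eq (A D : ℂ) {q : ℂ} (hq : ‖q‖ < 1) :
    ∑' k, onePhiOneTerm A D q k = (1 - D) * ∑' k, onePhiOneTerm A (D * q) q k := by
  have h1 := summable_onePhiOneTerm A D hq
  have h2 := summable_onePhiOneTerm A (D * q) hq
  set R : ℕ → ℂ := fun k => (1 - q ^ k) * onePhiOneTerm A D q k with hR
  have hRs : Summable R := by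
    refine .of_norm_bounded (h1.norm.mul_left 2) fun k => ?_
    rw [hR, norm_mul]
    refine mul_le_mul_of_nonneg_right ?_ (norm_nonneg _)
    have h3 := norm_sub_le 1 (q ^ k)
    have h4 : ‖q ^ k‖ ≤ 1 := by rw [norm_pow]; exact pow_le_one₀ (norm_nonneg _) hq.le
    rw [norm_one] at h3
    linarith
  have key : ∀ k, onePhiOneTerm A D q k - (1 - D) * onePhiOneTerm A (D * q) q k
      = R k - R (k + 1) := by
    intro k
    have e1 : qPochhammerInf (A * D * q ^ k) q =
        (1 - A * D * q ^ k) * qPochhammerInf (A * D * q ^ (k + 1)) q := by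
      have h := qPochhammerInf_eq_mul (A * D * q ^ k) hq 1
      rwa [pow_one, mul_assoc (A * D), ← pow_succ, qPochhammer_succ, qPochhammer_zero_right,
        pow_zero, mul_one, one_mul] at h
    have e2 : A * (D * q) * q ^ k = A * D * q ^ (k + 1) := by ring
    have e3 := qPochhammer_self_ne_zero hq (k + 1)
    have e4 := qPochhammer_self_ne_zero hq k
    rw [qPochhammer_succ] at e3
    have e5 := right_ne_zero_of_mul e3
    simp only [hR, onePhiOneTerm, e2, e1, qPochhammer_succ, succ_choose_two]
    generalize qPochhammerInf (A * D * q ^ (k + 1)) q = P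
    simp only [pow_succ', pow_add, neg_mul, mul_pow, neg_pow (D * q), neg_pow D]
    generalize q ^ k = x at e5 ⊢
    simp only [div_eq_mul_inv, mul_inv]
    linear_combination (-(qPochhammer A q k * (1 - A * x) * D * (-1) ^ k * D ^ k *
      (qPochhammer q q k)⁻¹ * q ^ k.choose 2 * x * P)) * mul_inv_cancel₀ e5
  have h3 : ∑' k, (R k - R (k + 1)) = 0 := by
    rw [hRs.tsum_sub ((summable_nat_add_iff 1).2 hRs), hRs.tsum_eq_zero_add]
    simp [hR]
  rw [← sub_eq_zero, ← tsum_mul_left, ← h1.tsum_sub (h2.mul_left _), ← h3]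
  exact tsum_congr key

/-- `₁φ₁(A; AD; q, D) = (D; q)_∞ / (AD; q)_∞`, in a form without denominators. -/
theorem hasSum_onePhiOneTerm (A D : ℂ) {q : ℂ} (hq : ‖q‖ < 1) :
    HasSum (onePhiOneTerm A D q) (qPochhammerInf D q) := by
  suffices h : ∑' k, onePhiOneTerm A D q k = qPochhammerInf D q from
    h ▸ (summable_onePhiOneTerm A D hq).hasSum
  -- Iterate the contiguous relation and let `N → ∞`; every term with `k > 0` then vanishes.
  have hN : ∀ N : ℕ, ∑' k, onePhiOneTerm A D q k =
      qPochhammer D q N * ∑' k, onePhiOneTerm A (D * q ^ N) q k := by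
    intro N
    induction N with
    | zero => simp [qPochhammer]
    | succ N ih =>
      rw [ih, tsum_onePhiOneTerm_eq _ _ hq, qPochhammer_succ, pow_succ]
      ring_nf
  have hlim : Tendsto (fun N : ℕ => ∑' k, onePhiOneTerm A (D * q ^ N) q k) atTop
      (𝓝 (∑' k : ℕ, if k = 0 then 1 else 0)) := by
    refine tendsto_tsum_of_dominated_convergence
      ((summable_pow_mul_pow_choose_two ((1 + ‖A‖) * ‖D‖ * (1 - ‖q‖)⁻¹)
        (norm_nonneg q) hq).mul_right (Real.exp (‖A * D‖ * (1 - ‖q‖)⁻¹))) (fun k => ?_)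
      (.of_forall fun N k => ?_)
    · have h1 := tendsto_qPochhammerInf_mul_pow (A * D * q ^ k) hq
      have h2 : Tendsto (fun N : ℕ => (-(D * q ^ N)) ^ k) atTop (𝓝 (if k = 0 then 1 else 0)) := by
        have := (((tendsto_pow_atTop_nhds_zero_of_norm_lt_one hq).const_mul D).neg).pow k
        simpa [zero_pow_eq] using this
      have h3 := (((h2.const_mul (qPochhammer A q k)).div_const (qPochhammer q q k)).mul_const
        (q ^ k.choose 2)).mul h1
      have h4 : qPochhammer A q k * (if k = 0 then 1 else 0) / qPochhammer q q k *
          q ^ k.choose 2 * 1 = if k = 0 then 1 else 0 := by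
        rcases k with _ | k <;> simp [qPochhammer]
      rw [h4] at h3
      refine h3.congr fun N => ?_
      simp only [onePhiOneTerm]
      congr 2
      ring
    · have hle : ‖D * q ^ N‖ ≤ ‖D‖ := by
        rw [norm_mul, norm_pow]
        exact mul_le_of_le_one_right (norm_nonneg _) (pow_le_one₀ (norm_nonneg _) hq.le)
      refine (norm_onePhiOneTerm_le A (D * q ^ N) hq k).trans ?_
      have := sub_pos.2 hq
      rw [norm_mul A, norm_mul A]
      gcongr
  rw [tsum_ite_eq] at hlim
  have h1 := (hasProd_qPochhammerInf D hq).tendsto_prod_nat.mul hlim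
  rw [mul_one] at h1
  exact tendsto_nhds_unique (tendsto_const_nhds.congr hN) h1

/-- The limiting case `c = 0` of the terminating `q`-Chu–Vandermonde sum:
`₂φ₁(q⁻ᵐ, y; 0; q, q) = yᵐ`. -/
theorem pow_eq_sum_qPochhammer {q : ℂ} (hq : ‖q‖ < 1) (hq0 : q ≠ 0) (y : ℂ) (m : ℕ) :
    y ^ m = ∑ i ∈ Finset.range (m + 1),
      qPochhammer (q⁻¹ ^ m) q i / qPochhammer q q i * q ^ i * qPochhammer y q i := by
  induction m with
  | zero => simp [qPochhammer]
  | succ m ih =>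
    set c : ℕ → ℕ → ℂ := fun m i => qPochhammer (q⁻¹ ^ m) q i / qPochhammer q q i * q ^ i with hc
    have hlast : c m (m + 1) = 0 := by
      have : q⁻¹ ^ m * q ^ m = 1 := by rw [← mul_pow, inv_mul_cancel₀ hq0, one_pow]
      simp only [hc, qPochhammer_succ, this, sub_self, mul_zero, zero_div, zero_mul]
    -- The `q`-Pascal rule for the coefficients, matching `y (y)_i = q⁻ⁱ ((y)_i - (y)_{i+1})`.
    have hrec : ∀ i, c (m + 1) (i + 1) = c m (i + 1) * q⁻¹ ^ (i + 1) - c m i * q⁻¹ ^ i := by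
      intro i
      have e0 := qPochhammer_self_ne_zero hq (i + 1)
      rw [qPochhammer_succ] at e0
      have e1 := left_ne_zero_of_mul e0
      have e2 := right_ne_zero_of_mul e0
      have e3 : q⁻¹ ^ (m + 1) * q = q⁻¹ ^ m := by
        rw [pow_succ, mul_assoc, inv_mul_cancel₀ hq0, mul_one]
      have e4 : q ^ (i + 1) * q⁻¹ ^ (i + 1) = 1 := by rw [← mul_pow, mul_inv_cancel₀ hq0, one_pow]
      have e5 : q ^ i * q⁻¹ ^ i = 1 := by rw [← mul_pow, mul_inv_cancel₀ hq0, one_pow]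
      simp only [hc, mul_assoc, e4, e5]
      rw [qPochhammer_succ', e3, qPochhammer_succ, qPochhammer_succ, ← e3]
      field_simp
      ring
    have hzero : c (m + 1) 0 = c m 0 := by simp [hc, qPochhammer]
    have hy : ∀ i, y * qPochhammer y q i =
        q⁻¹ ^ i * (qPochhammer y q i - qPochhammer y q (i + 1)) := by
      intro i
      have e5 : q⁻¹ ^ i * q ^ i = 1 := by rw [← mul_pow, inv_mul_cancel₀ hq0, one_pow]
      rw [qPochhammer_succ]
      linear_combination -(y * qPochhammer y q i) * e5
    have e : y ^ (m + 1) = ∑ i ∈ Finset.range (m + 1), c m i * q⁻¹ ^ i *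
        (qPochhammer y q i - qPochhammer y q (i + 1)) := by
      rw [pow_succ', ih, Finset.mul_sum]
      refine Finset.sum_congr rfl fun i _ => ?_
      linear_combination c m i * hy i
    have hshift : ∑ i ∈ Finset.range (m + 1), c m i * q⁻¹ ^ i * qPochhammer y q i =
        ∑ i ∈ Finset.range (m + 1), c m (i + 1) * q⁻¹ ^ (i + 1) * qPochhammer y q (i + 1)
          + c m 0 * q⁻¹ ^ 0 * qPochhammer y q 0 := by
      rw [← Finset.sum_range_succ' (fun i => c m i * q⁻¹ ^ i * qPochhammer y q i) (m + 1),
        Finset.sum_range_succ _ (m + 1), hlast]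
      ring
    change _ = ∑ i ∈ Finset.range (m + 1 + 1), c (m + 1) i * qPochhammer y q i
    rw [e, Finset.sum_range_succ' _ (m + 1), hzero]
    simp only [mul_sub, Finset.sum_sub_distrib, hrec, sub_mul, hshift]
    ring

theorem qPochhammer_inv_pow_eq_zero {q : ℂ} (hq0 : q ≠ 0) {k i : ℕ} (h : k < i) :
    qPochhammer (q⁻¹ ^ k) q i = 0 := by
  refine Finset.prod_eq_zero (Finset.mem_range.2 h) ?_
  rw [← mul_pow, inv_mul_cancel₀ hq0, one_pow, sub_self]

/-- `(q⁻ᴺ; q)_i` with its factors reversed, for `N = k + i`. -/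
theorem qPochhammer_inv_pow_mul {q : ℂ} (hq0 : q ≠ 0) (k i : ℕ) :
    qPochhammer (q⁻¹ ^ (k + i)) q i * qPochhammer q q k =
      qPochhammer q q (k + i) * (-1) ^ i * q⁻¹ ^ ((i + 1).choose 2 + k * i) := by
  induction i with
  | zero => simp [qPochhammer]
  | succ i ih =>
    have e3 : q⁻¹ ^ (k + i + 1) * q = q⁻¹ ^ (k + i) := by
      rw [pow_succ, mul_assoc, inv_mul_cancel₀ hq0, mul_one]
    have e4 : q⁻¹ ^ (k + i + 1) * q ^ (k + i + 1) = 1 := by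
      rw [← mul_pow, inv_mul_cancel₀ hq0, one_pow]
    rw [← add_assoc, qPochhammer_succ', e3, mul_assoc, ih, qPochhammer_succ, ← pow_succ',
      succ_choose_two (i + 1),
      show (i + 1).choose 2 + (i + 1) + k * (i + 1) =
        ((i + 1).choose 2 + k * i) + (k + i + 1) by ring, pow_add q⁻¹ _ (k + i + 1)]
    linear_combination (qPochhammer q q (k + i) * (-1) ^ i *
      q⁻¹ ^ ((i + 1).choose 2 + k * i)) * (-e4)

/-- The `₁φ₁` series with argument `q⁻ᵐ D` instead of `D` is a terminating sum: expand `q⁻ᵐᵏ` by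
`pow_eq_sum_qPochhammer` at `y = q⁻ᵏ` and apply the `₁φ₁` summation with `A q^i` in place
of `A`. -/
theorem hasSum_onePhiOneTerm_mul_inv_pow (A D : ℂ) {q : ℂ} (hq : ‖q‖ < 1) (hq0 : q ≠ 0)
    (m : ℕ) :
    HasSum (fun k => onePhiOneTerm A D q k * q⁻¹ ^ (m * k))
      (qPochhammerInf D q * ∑ i ∈ Finset.range (m + 1),
        qPochhammer (q⁻¹ ^ m) q i * qPochhammer A q i / qPochhammer q q i * D ^ i) := by
  have hi : ∀ i : ℕ, HasSum (fun k => onePhiOneTerm A D q k * (q ^ i * qPochhammer (q⁻¹ ^ k) q i))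
      (qPochhammer A q i * D ^ i * qPochhammerInf D q) := by
    intro i
    -- The terms with `k < i` vanish because `(q⁻ᵏ; q)_i = 0`; shift `k` by `i`.
    have h0 : ∑ k ∈ Finset.range i,
        onePhiOneTerm A D q k * (q ^ i * qPochhammer (q⁻¹ ^ k) q i) = 0 :=
      Finset.sum_eq_zero fun k hk => by
        rw [qPochhammer_inv_pow_eq_zero hq0 (Finset.mem_range.1 hk), mul_zero, mul_zero]
    rw [← hasSum_nat_add_iff' i, h0, sub_zero]
    refine ((hasSum_onePhiOneTerm (A * q ^ i) D hq).mul_left (qPochhammer A q i * D ^ i)).congr_fun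
      fun k => ?_
    have e1 := qPochhammer_inv_pow_mul hq0 k i
    have e2 := qPochhammer_self_ne_zero hq (k + i)
    have e3 := qPochhammer_self_ne_zero hq k
    have e4 : qPochhammer (q⁻¹ ^ (k + i)) q i / qPochhammer q q (k + i) =
        (-1) ^ i * q⁻¹ ^ ((i + 1).choose 2 + k * i) / qPochhammer q q k := by
      rw [div_eq_div_iff e2 e3, e1]
      ring
    have e5 : q ^ (k + i).choose 2 * q ^ i * q⁻¹ ^ ((i + 1).choose 2 + k * i) =
        q ^ k.choose 2 := by
      rw [add_choose_two, succ_choose_two, inv_pow, ← div_eq_mul_inv,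
        div_eq_iff (pow_ne_zero _ hq0), ← pow_add, ← pow_add]
      ring_nf
    have e6 : A * D * q ^ (k + i) = A * q ^ i * D * q ^ k := by ring
    have e7 : qPochhammer A q (k + i) = qPochhammer A q i * qPochhammer (A * q ^ i) q k := by
      rw [add_comm, qPochhammer_add]
    have e8 : (-1 : ℂ) ^ i * (-1) ^ i = 1 := by rw [← mul_pow]; norm_num
    simp only [onePhiOneTerm]
    rw [e6, e7, ← e5, neg_pow D (k + i), neg_pow D k, pow_add, pow_add D]
    set P := qPochhammerInf (A * q ^ i * D * q ^ k) q
    calc _ = qPochhammer A q i * D ^ i * qPochhammer (A * q ^ i) q k * ((-1) ^ k * (-1) ^ i * D ^ k)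
          * q ^ (k + i).choose 2 * q ^ i * P *
          (qPochhammer (q⁻¹ ^ (k + i)) q i / qPochhammer q q (k + i)) := by ring
      _ = _ := by
        rw [e4]
        linear_combination (qPochhammer A q i * D ^ i * qPochhammer (A * q ^ i) q k * (-1) ^ k *
          D ^ k * q ^ (k + i).choose 2 * q ^ i * P * q⁻¹ ^ ((i + 1).choose 2 + k * i) /
          qPochhammer q q k) * e8
  have h1 := hasSum_sum (s := Finset.range (m + 1)) fun i _ =>
    (hi i).mul_left (qPochhammer (q⁻¹ ^ m) q i / qPochhammer q q i)
  have hv : qPochhammerInf D q * ∑ i ∈ Finset.range (m + 1),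
        qPochhammer (q⁻¹ ^ m) q i * qPochhammer A q i / qPochhammer q q i * D ^ i =
      ∑ i ∈ Finset.range (m + 1), qPochhammer (q⁻¹ ^ m) q i / qPochhammer q q i *
        (qPochhammer A q i * D ^ i * qPochhammerInf D q) := by
    rw [Finset.mul_sum]
    exact Finset.sum_congr rfl fun i _ => by ring
  rw [hv]
  refine h1.congr_fun fun k => ?_
  rw [mul_comm m k, pow_mul, pow_eq_sum_qPochhammer hq hq0 (q⁻¹ ^ k) m, Finset.mul_sum]
  exact Finset.sum_congr rfl fun i _ => by ring

/-! ### Al-Salam–Chihara polynomials as convolutions -/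

/-- The coefficient of `t^k` in `(ct; q)_∞ / (zt; q)_∞`, by the `q`-binomial theorem. -/
noncomputable def qBinomialCoeff (c q z : ℂ) (k : ℕ) : ℂ :=
  qPochhammer (c * z⁻¹) q k / qPochhammer q q k * z ^ k

/-- The coefficient of `t^n` in `(at, bt; q)_∞ / (zt, t/z; q)_∞`. For `z = exp (iθ)` this is
`Q_n (cos θ; a, b | q) / (q; q)_n`. -/
noncomputable def ascConvolution (a b q z : ℂ) (n : ℕ) : ℂ :=
  ∑ p ∈ Finset.HasAntidiagonal.antidiagonal n, qBinomialCoeff a q z p.1 * qBinomialCoeff b q z⁻¹ p.2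

theorem norm_qBinomialCoeff_le (c z : ℂ) {q : ℂ} (hq : ‖q‖ < 1) (k : ℕ) :
    ‖qBinomialCoeff c q z k‖ ≤ ((1 + ‖c * z⁻¹‖) * ‖z‖ * (1 - ‖q‖)⁻¹) ^ k := by
  rw [qBinomialCoeff, div_mul_eq_mul_div]
  exact norm_mul_pow_div_le _ _ hq k

theorem exists_norm_ascConvolution_le (a b z : ℂ) {q : ℂ} (hq : ‖q‖ < 1) :
    ∃ M : ℝ, 0 ≤ M ∧ ∀ n, ‖ascConvolution a b q z n‖ ≤ M ^ n := by
  have h0 := sub_pos.2 hq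
  set X := (1 + ‖a * z⁻¹‖) * ‖z‖ * (1 - ‖q‖)⁻¹
  set Y := (1 + ‖b * z⁻¹⁻¹‖) * ‖z⁻¹‖ * (1 - ‖q‖)⁻¹
  have hX0 : 0 ≤ X := by positivity
  have hY0 : 0 ≤ Y := by positivity
  refine ⟨2 * (X + Y), by positivity, fun n => ?_⟩
  have h1 : ∀ p ∈ Finset.HasAntidiagonal.antidiagonal n,
      ‖qBinomialCoeff a q z p.1 * qBinomialCoeff b q z⁻¹ p.2‖ ≤ (X + Y) ^ n := by
    intro p hp
    rw [norm_mul, ← Finset.HasAntidiagonal.mem_antidiagonal.1 hp, pow_add]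
    refine mul_le_mul ((norm_qBinomialCoeff_le a z hq _).trans ?_)
      ((norm_qBinomialCoeff_le b z⁻¹ hq _).trans ?_) (norm_nonneg _) (by positivity)
    · exact pow_le_pow_left₀ hX0 (by linarith) _
    · exact pow_le_pow_left₀ hY0 (by linarith) _
  refine (norm_sum_le_of_le _ h1).trans ?_
  rw [Finset.sum_const, Finset.Nat.card_antidiagonal, nsmul_eq_mul, mul_pow]
  refine mul_le_mul_of_nonneg_right ?_ (by positivity)
  exact_mod_cast (Nat.lt_two_pow_self (n := n))

open PowerSeries in
/-- The functional equation `(1 - zt) V(t) = (1 - ct) V(qt)` of `V(t) = (ct; q)_∞ / (zt; q)_∞`. -/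
theorem qBinomialCoeff_functional_equation (c z : ℂ) {q : ℂ} (hq : ‖q‖ < 1) (hz : z ≠ 0) :
    (1 - C z * X) * mk (qBinomialCoeff c q z) =
      (1 - C c * X) * rescale q (mk (qBinomialCoeff c q z)) := by
  ext n
  rw [sub_mul, sub_mul, one_mul, one_mul, mul_assoc, mul_assoc]
  rcases n with _ | n
  · simp only [map_sub, coeff_C_mul, coeff_zero_X_mul, coeff_rescale, coeff_mk, pow_zero, one_mul]
    ring
  · simp only [map_sub, coeff_C_mul, coeff_succ_X_mul, coeff_rescale, coeff_mk, qBinomialCoeff]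
    have e0 := qPochhammer_self_ne_zero hq (n + 1)
    rw [qPochhammer_succ] at e0
    have e1 := left_ne_zero_of_mul e0
    have e2 := right_ne_zero_of_mul e0
    rw [qPochhammer_succ, qPochhammer_succ, pow_succ, pow_succ']
    generalize q ^ n = x at e2 ⊢
    have e3 : 1 - x * q ≠ 0 := by rwa [mul_comm]
    field_simp
    ring

open PowerSeries in
/-- The three-term recurrence of the Al-Salam–Chihara polynomials, read off from
`(1 - zt)(1 - t/z) W(t) = (1 - at)(1 - bt) W(qt)` for the generating function `W`. -/
theorem ascConvolution_recurrence (a b z : ℂ) {q : ℂ} (hq : ‖q‖ < 1) (hz : z ≠ 0) (n : ℕ) :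
    (1 - q ^ (n + 2)) * ascConvolution a b q z (n + 2) =
      (z + z⁻¹ - (a + b) * q ^ (n + 1)) * ascConvolution a b q z (n + 1) -
        (1 - a * b * q ^ n) * ascConvolution a b q z n := by
  set V : ℂ⟦X⟧ := mk (qBinomialCoeff a q z)
  set U : ℂ⟦X⟧ := mk (qBinomialCoeff b q z⁻¹)
  have hW : ∀ n, coeff n (V * U) = ascConvolution a b q z n := fun n => by
    simp [V, U, coeff_mul, ascConvolution]
  have h : (1 - C z * X) * (1 - C z⁻¹ * X) * (V * U) =
      (1 - C a * X) * (1 - C b * X) * rescale q (V * U) := by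
    rw [map_mul]
    calc _ = ((1 - C z * X) * V) * ((1 - C z⁻¹ * X) * U) := by ring
      _ = _ := by
        rw [qBinomialCoeff_functional_equation a z hq hz,
          qBinomialCoeff_functional_equation b z⁻¹ hq (inv_ne_zero hz)]
        ring
  have expand : ∀ (s t : ℂ) (W : ℂ⟦X⟧), coeff (n + 2) ((1 - C s * X) * (1 - C t * X) * W) =
      coeff (n + 2) W - (s + t) * coeff (n + 1) W + s * t * coeff n W := by
    intro s t W
    have : (1 - C s * X) * (1 - C t * X) * W =
        W - C (s + t) * (X * W) + C (s * t) * (X * (X * W)) := by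
      rw [map_add, map_mul]; ring
    rw [this, map_add (coeff (n + 2)), map_sub]
    simp only [coeff_C_mul, coeff_succ_X_mul]
  have h2 := congrArg (coeff (n + 2)) h
  rw [expand, expand, coeff_rescale, coeff_rescale, coeff_rescale, hW, hW, hW,
    mul_inv_cancel₀ hz] at h2
  linear_combination h2

theorem alSalamChihara_eq (a b q x : ℝ) (hq0 : 0 < q) (hq1 : q < 1) {z : ℂ} (hz : z ≠ 0)
    (hx : z + z⁻¹ = 2 * x) (n : ℕ) :
    (alSalamChihara a b q x n : ℂ) = qPochhammer q q n * ascConvolution a b q z n := by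
  have hq : ‖(q : ℂ)‖ < 1 := by rwa [Complex.norm_real, Real.norm_of_nonneg hq0.le]
  induction n using Nat.twoStepInduction with
  | zero => simp [alSalamChihara, ascConvolution, qBinomialCoeff, qPochhammer]
  | one =>
    have h1 : (1 : ℂ) - q ≠ 0 := by
      simpa [qPochhammer] using qPochhammer_self_ne_zero hq 1
    simp only [alSalamChihara, ascConvolution, qBinomialCoeff, qPochhammer,
      Finset.Nat.antidiagonal_succ]
    push_cast
    rw [← hx]
    simp
    field_simp
    ring
  | more n ih1 ih2 =>
    have h := ascConvolution_recurrence a b z hq hz n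
    rw [hx] at h
    rw [alSalamChihara]
    push_cast
    rw [ih1, ih2, qPochhammer_succ _ _ (n + 1), qPochhammer_succ]
    linear_combination (-(qPochhammer q q n * (1 - q * q ^ n) : ℂ)) * h

/-! ### The generating function at `t = q⁻ᵐ` and its dual form -/

theorem hasSum_sum_antidiagonal {f : ℕ × ℕ → ℂ} {s : ℂ} (h : HasSum f s) :
    HasSum (fun n => ∑ p ∈ Finset.HasAntidiagonal.antidiagonal n, f p) s := by
  rw [← Finset.HasAntidiagonal.sigmaAntidiagonalEquivProd.hasSum_iff] at h
  refine h.sigma fun n => ?_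
  rw [← Finset.sum_coe_sort]
  exact hasSum_fintype _

/-- The generating function `∑ (-α)^n q^{n(n-1)/2} t^n Q_n(x; α, b | q) / (q, αb; q)_n` at
`t = q⁻ᵐ`, multiplied by `(αb; q)_∞`. Writing `Q_n` as a convolution turns it into a double
series, in which both summations are of `₁φ₁` type. -/
theorem hasSum_ascConvolution_mul_inv_pow (α b z : ℂ) {q : ℂ} (hq : ‖q‖ < 1) (hq0 : q ≠ 0)
    (hz : z ≠ 0) (m : ℕ) :
    HasSum (fun n => (-α) ^ n * q ^ n.choose 2 * q⁻¹ ^ (m * n) *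
        qPochhammerInf (α * b * q ^ n) q * ascConvolution α b q z n)
      (qPochhammerInf (α * z⁻¹) q * ∑ i ∈ Finset.range (m + 1),
        qPochhammer (q⁻¹ ^ m) q i * qPochhammer (b * z) q i / qPochhammer q q i *
          (α * z⁻¹) ^ i * qPochhammerInf (α * z * q⁻¹ ^ m * q ^ i) q) := by
  set F : ℕ × ℕ → ℂ := fun p => (-α) ^ (p.1 + p.2) * q ^ (p.1 + p.2).choose 2 *
    q⁻¹ ^ (m * (p.1 + p.2)) * qPochhammerInf (α * b * q ^ (p.1 + p.2)) q *
    (qBinomialCoeff α q z p.1 * qBinomialCoeff b q z⁻¹ p.2) with hF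
  have h0 := sub_pos.2 hq
  have hFs : Summable F := by
    set X := (1 + ‖α * z⁻¹‖) * ‖z‖ * (1 - ‖q‖)⁻¹
    set Y := (1 + ‖b * z⁻¹⁻¹‖) * ‖z⁻¹‖ * (1 - ‖q‖)⁻¹
    set W := ‖α‖ * ‖q⁻¹‖ ^ m
    have hs1 := summable_pow_mul_pow_choose_two (W * X) (norm_nonneg q) hq
    have hs2 := summable_pow_mul_pow_choose_two (W * Y) (norm_nonneg q) hq
    refine .of_norm_bounded ((hs1.mul_of_nonneg hs2 (fun _ => by positivity)
      (fun _ => by positivity)).mul_left (Real.exp (‖α * b‖ * (1 - ‖q‖)⁻¹))) fun ⟨j, k⟩ => ?_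
    have e1 : ‖q‖ ^ (j + k).choose 2 ≤ ‖q‖ ^ j.choose 2 * ‖q‖ ^ k.choose 2 := by
      rw [add_choose_two, ← pow_add]
      exact pow_le_pow_of_le_one (norm_nonneg _) hq.le (by omega)
    calc ‖F (j, k)‖ = (W ^ j * W ^ k) * ‖q‖ ^ (j + k).choose 2 *
          ‖qPochhammerInf (α * b * q ^ (j + k)) q‖ *
          (‖qBinomialCoeff α q z j‖ * ‖qBinomialCoeff b q z⁻¹ k‖) := by
          simp only [hF, norm_mul, norm_pow, norm_neg, W]
          ring
      _ ≤ (W ^ j * W ^ k) * (‖q‖ ^ j.choose 2 * ‖q‖ ^ k.choose 2) *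
          Real.exp (‖α * b‖ * (1 - ‖q‖)⁻¹) * (X ^ j * Y ^ k) := by
          gcongr
          · exact norm_qPochhammerInf_mul_pow_le _ hq _
          · exact norm_qBinomialCoeff_le α z hq j
          · exact norm_qBinomialCoeff_le b z⁻¹ hq k
      _ = _ := by ring_nf
  -- For fixed `j` the series over `k` is `₁φ₁(bz; αbq^j; q, q⁻ᵐ αq^j/z)`.
  have hrow : ∀ j, HasSum (fun k => F (j, k)) (qPochhammerInf (α * z⁻¹) q *
      ∑ i ∈ Finset.range (m + 1),
        qPochhammer (q⁻¹ ^ m) q i * qPochhammer (b * z) q i / qPochhammer q q i *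
          (α * z⁻¹) ^ i * onePhiOneTerm 0 (α * z * q⁻¹ ^ m * q ^ i) q j) := by
    intro j
    have h1 := (hasSum_onePhiOneTerm_mul_inv_pow (b * z) (α * z⁻¹ * q ^ j) hq hq0 m).mul_left
      (qBinomialCoeff α q z j * (-α) ^ j * q ^ j.choose 2 * q⁻¹ ^ (m * j))
    have hv : qBinomialCoeff α q z j * (-α) ^ j * q ^ j.choose 2 * q⁻¹ ^ (m * j) *
        (qPochhammerInf (α * z⁻¹ * q ^ j) q * ∑ i ∈ Finset.range (m + 1),
          qPochhammer (q⁻¹ ^ m) q i * qPochhammer (b * z) q i / qPochhammer q q i *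
            (α * z⁻¹ * q ^ j) ^ i) = qPochhammerInf (α * z⁻¹) q *
      ∑ i ∈ Finset.range (m + 1),
        qPochhammer (q⁻¹ ^ m) q i * qPochhammer (b * z) q i / qPochhammer q q i *
          (α * z⁻¹) ^ i * onePhiOneTerm 0 (α * z * q⁻¹ ^ m * q ^ i) q j := by
      rw [qPochhammerInf_eq_mul (α * z⁻¹) hq j, ← mul_assoc, Finset.mul_sum, Finset.mul_sum]
      refine Finset.sum_congr rfl fun i _ => ?_
      simp only [onePhiOneTerm, qBinomialCoeff, zero_mul, qPochhammer_zero_left,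
        qPochhammerInf_zero_left]
      ring
    rw [← hv]
    refine h1.congr_fun fun k => ?_
    have e1 : b * z * (α * z⁻¹ * q ^ j) * q ^ k = α * b * q ^ (j + k) := by
      field_simp
      ring
    simp only [hF, onePhiOneTerm, e1, add_choose_two, qBinomialCoeff, inv_inv]
    ring
  have hcol : HasSum (fun j => qPochhammerInf (α * z⁻¹) q *
      ∑ i ∈ Finset.range (m + 1),
        qPochhammer (q⁻¹ ^ m) q i * qPochhammer (b * z) q i / qPochhammer q q i *
          (α * z⁻¹) ^ i * onePhiOneTerm 0 (α * z * q⁻¹ ^ m * q ^ i) q j)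
      (qPochhammerInf (α * z⁻¹) q * ∑ i ∈ Finset.range (m + 1),
        qPochhammer (q⁻¹ ^ m) q i * qPochhammer (b * z) q i / qPochhammer q q i *
          (α * z⁻¹) ^ i * qPochhammerInf (α * z * q⁻¹ ^ m * q ^ i) q) :=
    (hasSum_sum fun i _ => (hasSum_onePhiOneTerm 0 _ hq).mul_left _).mul_left _
  have hsum := hFs.hasSum
  rw [(hsum.prod_fiberwise hrow).unique hcol] at hsum
  refine (hasSum_sum_antidiagonal hsum).congr_fun fun n => ?_
  rw [ascConvolution, Finset.mul_sum]
  refine Finset.sum_congr rfl fun p hp => ?_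
  simp only [hF, Finset.HasAntidiagonal.mem_antidiagonal.1 hp]

/-- `(y q⁻ʲ; q)_j` with its factors reversed. -/
theorem qPochhammer_mul_inv_pow {q y : ℂ} (hq0 : q ≠ 0) (hy : y ≠ 0) (j : ℕ) :
    qPochhammer (y * q⁻¹ ^ j) q j =
      qPochhammer (q * y⁻¹) q j * (-y) ^ j * q⁻¹ ^ (j + 1).choose 2 := by
  induction j with
  | zero => simp [qPochhammer]
  | succ j ih =>
    have e1 : y * q⁻¹ ^ (j + 1) * q = y * q⁻¹ ^ j := by
      rw [pow_succ]; field_simp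
    have e2 : q⁻¹ ^ (j + 1) * q ^ (j + 1) = 1 := by
      rw [← mul_pow, inv_mul_cancel₀ hq0, one_pow]
    have e3 : y * y⁻¹ = 1 := mul_inv_cancel₀ hy
    rw [qPochhammer_succ', e1, ih, qPochhammer_succ, succ_choose_two (j + 1), pow_add q⁻¹,
      pow_succ (-y)]
    rw [pow_succ' q] at e2
    linear_combination (-(qPochhammer (q * y⁻¹) q j * (-y) ^ j * q⁻¹ ^ (j + 1).choose 2)) *
      (e2 + (q * q ^ j * q⁻¹ ^ (j + 1)) * e3)

/-- Duality: up to elementary factors, the terminating sum that evaluates the generating function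
of the `Q_n(x; a, b | q)` at `t = q⁻ᵐ` is `Q_m(x; q/a, b | q)`. -/
theorem sum_eq_ascConvolution_dual {a b z q : ℂ} (hq : ‖q‖ < 1) (hq0 : q ≠ 0)
    (ha : a ≠ 0) (hz : z ≠ 0) (m : ℕ) :
    ∑ i ∈ Finset.range (m + 1),
        qPochhammer (q⁻¹ ^ m) q i * qPochhammer (b * z) q i / qPochhammer q q i *
          (a * z⁻¹) ^ i * qPochhammerInf (a * z * q⁻¹ ^ m * q ^ i) q =
      qPochhammerInf (a * z) q * qPochhammer q q m * (-a) ^ m * q⁻¹ ^ (m + 1).choose 2 *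
        ascConvolution (q / a) b q z m := by
  rw [ascConvolution, ← Finset.Nat.sum_antidiagonal_swap, Finset.mul_sum,
    Finset.Nat.sum_antidiagonal_eq_sum_range_succ_mk]
  refine Finset.sum_congr rfl fun i hi => ?_
  obtain ⟨j, rfl⟩ := Nat.exists_eq_add_of_le (Nat.lt_succ_iff.1 (Finset.mem_range.1 hi))
  have e1 : a * z * q⁻¹ ^ (i + j) * q ^ i = a * z * q⁻¹ ^ j := by
    rw [pow_add]
    have : q⁻¹ ^ i * q ^ i = 1 := by rw [← mul_pow, inv_mul_cancel₀ hq0, one_pow]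
    linear_combination (a * z * q⁻¹ ^ j) * this
  have e2 : a * z * q⁻¹ ^ j * q ^ j = a * z := by
    rw [mul_assoc, ← mul_pow, inv_mul_cancel₀ hq0, one_pow, mul_one]
  have e3 := qPochhammer_inv_pow_mul hq0 j i
  rw [add_comm j i] at e3
  have e4 := qPochhammer_self_ne_zero hq j
  have e5 : qPochhammer (q⁻¹ ^ (i + j)) q i = qPochhammer q q (i + j) * (-1) ^ i *
      q⁻¹ ^ ((i + 1).choose 2 + j * i) / qPochhammer q q j := by
    rw [eq_div_iff e4, e3]
  have e6 : (i + j + 1).choose 2 = (i + 1).choose 2 + j * i + (j + 1).choose 2 := by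
    simp only [succ_choose_two, add_choose_two]
    ring
  have e7 : q / a * z⁻¹ = q * (a * z)⁻¹ := by rw [mul_inv, div_eq_mul_inv, mul_assoc]
  simp only [Prod.fst_swap, Prod.snd_swap, add_tsub_cancel_left, e1]
  rw [qPochhammerInf_eq_mul (a * z * q⁻¹ ^ j) hq j, e2,
    qPochhammer_mul_inv_pow hq0 (mul_ne_zero ha hz), e5, e6, pow_add q⁻¹ _ ((j + 1).choose 2)]
  simp only [qBinomialCoeff, inv_inv, e7, neg_pow a (i + j), neg_pow (a * z) j]
  simp only [pow_add (-1 : ℂ), pow_add a, mul_pow]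
  ring

/-! ### Absolute convergence and interchange of the two summations -/

/-- The terms of `₀φ₁(-; c; q; q^{2-n} / a²)`. -/
theorem basicHypergeometricTerm_eq {a c q : ℂ} (hq0 : q ≠ 0) (n m : ℕ) :
    basicHypergeometricTerm [] [c] q (q ^ (2 - (n : ℤ)) / a ^ 2) m =
      (qPochhammer c q m)⁻¹ * (qPochhammer q q m)⁻¹ * (q ^ 2 / a ^ 2) ^ m *
        (q ^ m.choose 2 * q ^ m.choose 2) * q⁻¹ ^ (m * n) := by
  have e1 : q ^ (2 - (n : ℤ)) = q ^ 2 * q⁻¹ ^ n := by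
    rw [zpow_sub₀ hq0, zpow_natCast, inv_pow, ← div_eq_mul_inv]
    norm_cast
  have e2 : (1 + (([c] : List ℂ).length : ℤ) - (([] : List ℂ).length : ℤ)) = ((2 : ℕ) : ℤ) := by
    simp
  rw [basicHypergeometricTerm, e2, zpow_natCast, e1, ← Nat.choose_two_right]
  have e3 : ((-1 : ℂ) ^ m) ^ 2 = 1 := by rw [← pow_mul, mul_comm, pow_mul]; simp
  simp only [List.map_nil, List.prod_nil, List.map_cons, List.prod_cons, mul_one, one_div, mul_pow,
    e3, div_pow, mul_comm m n, pow_mul]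
  ring

theorem norm_basicHypergeometricTerm_le {a c q : ℂ} (hq : ‖q‖ < 1) (hq0 : q ≠ 0)
    (hc : ∀ k : ℕ, c * q ^ k ≠ 1) (n m : ℕ) :
    ‖basicHypergeometricTerm [] [c] q (q ^ (2 - (n : ℤ)) / a ^ 2) m‖ ≤
      Real.exp (‖c‖ * (1 - ‖q‖)⁻¹) / ‖qPochhammerInf c q‖ *
        (((1 - ‖q‖)⁻¹ * ‖q ^ 2 / a ^ 2‖) ^ m *
          (‖q‖ ^ m.choose 2 * ‖q‖ ^ m.choose 2) * ‖q‖⁻¹ ^ (m * n)) := by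
  rw [basicHypergeometricTerm_eq hq0]
  have h0 := sub_pos.2 hq
  calc _ = ‖(qPochhammer c q m)⁻¹‖ * (‖(qPochhammer q q m)⁻¹‖ * ‖q ^ 2 / a ^ 2‖ ^ m *
        (‖q‖ ^ m.choose 2 * ‖q‖ ^ m.choose 2) * ‖q‖⁻¹ ^ (m * n)) := by
        simp only [norm_mul, norm_pow, norm_inv q]
        ring
    _ ≤ Real.exp (‖c‖ * (1 - ‖q‖)⁻¹) / ‖qPochhammerInf c q‖ *
        ((1 - ‖q‖)⁻¹ ^ m * ‖q ^ 2 / a ^ 2‖ ^ m *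
        (‖q‖ ^ m.choose 2 * ‖q‖ ^ m.choose 2) * ‖q‖⁻¹ ^ (m * n)) := by
        gcongr
        · exact norm_inv_qPochhammer_le hq hc m
        · exact norm_inv_qPochhammer_self_le hq m
    _ = _ := by rw [mul_pow]

theorem summable_basicHypergeometricTerm {a c q : ℂ} (hq : ‖q‖ < 1) (hq0 : q ≠ 0)
    (hc : ∀ k : ℕ, c * q ^ k ≠ 1) (n : ℕ) :
    Summable (basicHypergeometricTerm [] [c] q (q ^ (2 - (n : ℤ)) / a ^ 2)) := by
  have h0 := sub_pos.2 hq
  have hs := summable_pow_mul_pow_choose_two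
    ((1 - ‖q‖)⁻¹ * ‖q ^ 2 / a ^ 2‖ * ‖q‖⁻¹ ^ n) (norm_nonneg q) hq
  refine .of_norm_bounded (hs.mul_left (Real.exp (‖c‖ * (1 - ‖q‖)⁻¹) / ‖qPochhammerInf c q‖))
    fun m => (norm_basicHypergeometricTerm_le hq hq0 hc n m).trans ?_
  refine mul_le_mul_of_nonneg_left ?_ (by positivity)
  rw [mul_pow (_ * _) (‖q‖⁻¹ ^ n), ← pow_mul, mul_comm n m, mul_right_comm]
  refine mul_le_mul_of_nonneg_left ?_ (by positivity)
  exact mul_le_of_le_one_left (by positivity) (pow_le_one₀ (norm_nonneg _) hq.le)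

/-- The quadratic form `n²/2 + m² - nm` is positive definite, so Gaussian decay beats the factor
`r^{-nm}`. -/
theorem summable_gaussian_prod {X Y r : ℝ} (hX : 0 ≤ X) (hY : 0 ≤ Y) (h0 : 0 < r) (h1 : r < 1) :
    Summable fun p : ℕ × ℕ => X ^ p.1 * r ^ p.1.choose 2 *
      (Y ^ p.2 * (r ^ p.2.choose 2 * r ^ p.2.choose 2) * r⁻¹ ^ (p.2 * p.1)) := by
  -- With `r = s⁴` the exponent is at least a quarter of `n(n-1)/2 + m(m-1)/2 - 4n - 4m`.
  obtain ⟨s, hs0, hs1, rfl⟩ : ∃ s : ℝ, 0 < s ∧ s < 1 ∧ r = s ^ 4 := by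
    refine ⟨√(√r), by positivity, ?_, ?_⟩
    · rw [Real.sqrt_lt' one_pos, Real.sqrt_lt' (by norm_num)]
      simpa using h1
    · rw [show (4 : ℕ) = 2 * 2 from rfl, pow_mul, Real.sq_sqrt (Real.sqrt_nonneg _),
        Real.sq_sqrt h0.le]
  have hA := summable_pow_mul_pow_choose_two (X * s⁻¹ ^ 4) hs0.le hs1
  have hB := summable_pow_mul_pow_choose_two (Y * s⁻¹ ^ 4) hs0.le hs1
  refine .of_nonneg_of_le (fun _ => by positivity) (fun p => ?_)
    (hA.mul_of_nonneg hB (fun _ => by positivity) fun _ => by positivity)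
  obtain ⟨n, m⟩ := p
  have hexp : n.choose 2 + m.choose 2 + 4 * (m * n) ≤
      4 * n.choose 2 + 8 * m.choose 2 + 4 * n + 4 * m := by
    have hT : ∀ k : ℕ, 2 * (k.choose 2 : ℤ) = k * k - k := fun k => by
      induction k with
      | zero => simp
      | succ k ih => rw [succ_choose_two]; push_cast; linarith
    zify
    nlinarith [hT n, hT m, sq_nonneg (3 * (n : ℤ) - 4 * m), sq_nonneg (m : ℤ)]
  have hpow : s ^ (4 * n.choose 2 + 8 * m.choose 2 + 4 * n + 4 * m) ≤
      s ^ (n.choose 2 + m.choose 2 + 4 * (m * n)) :=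
    pow_le_pow_of_le_one hs0.le hs1.le hexp
  have hs : s ≠ 0 := hs0.ne'
  calc X ^ n * (s ^ 4) ^ n.choose 2 *
        (Y ^ m * ((s ^ 4) ^ m.choose 2 * (s ^ 4) ^ m.choose 2) * (s ^ 4)⁻¹ ^ (m * n))
      = X ^ n * Y ^ m * (s ^ (4 * n.choose 2 + 8 * m.choose 2 + 4 * n + 4 * m) /
          s ^ (4 * n + 4 * m + 4 * (m * n))) := by
        rw [inv_pow, ← pow_mul, ← pow_mul, ← pow_mul]
        field_simp
        ring
    _ ≤ X ^ n * Y ^ m * (s ^ (n.choose 2 + m.choose 2 + 4 * (m * n)) /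
          s ^ (4 * n + 4 * m + 4 * (m * n))) := by gcongr
    _ = _ := by
        rw [mul_pow, mul_pow, ← pow_mul, ← pow_mul, inv_pow, inv_pow]
        field_simp
        ring

/-- The identity for complex parameters, with the polynomials in convolution form. Summing over
`n` first gives, by duality, the terms of the same generating function at `m = 0` with `q/a` in
place of `a`. -/
theorem hasSum_ascConvolution_mul_basicHypergeometric {a b z q : ℂ} (hq : ‖q‖ < 1) (hq0 : q ≠ 0)
    (ha : a ≠ 0) (hz : z ≠ 0) (hab : ∀ k : ℕ, a * b * q ^ k ≠ 1)
    (hc : ∀ k : ℕ, q * b / a * q ^ k ≠ 1) :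
    HasSum (fun n : ℕ => (-a) ^ n * q ^ n.choose 2 / qPochhammer (a * b) q n *
        ascConvolution a b q z n *
        basicHypergeometric [] [q * b / a] q (q ^ (2 - (n : ℤ)) / a ^ 2))
      (qPochhammerInf (a * z⁻¹) q * qPochhammerInf (a * z) q *
          qPochhammerInf (q * z⁻¹ / a) q * qPochhammerInf (q * z / a) q /
        (qPochhammerInf (a * b) q * qPochhammerInf (q * b / a) q)) := by
  set c := q * b / a with hcdef
  set w : ℕ → ℂ := fun n => (-a) ^ n * q ^ n.choose 2 / qPochhammer (a * b) q n *
        ascConvolution a b q z n with hw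
  set H : ℕ → ℕ → ℂ := fun n m =>
    basicHypergeometricTerm [] [c] q (q ^ (2 - (n : ℤ)) / a ^ 2) m with hH
  have hab' := qPochhammerInf_ne_zero hq hab
  have hc' := qPochhammerInf_ne_zero hq hc
  have h0 := sub_pos.2 hq
  have hsum : Summable fun p : ℕ × ℕ => w p.1 * H p.1 p.2 := by
    obtain ⟨M, hM0, hM⟩ := exists_norm_ascConvolution_le a b z hq
    have hs := summable_gaussian_prod (X := ‖a‖ * M) (Y := (1 - ‖q‖)⁻¹ * ‖q ^ 2 / a ^ 2‖)
      (by positivity) (by positivity) (norm_pos_iff.2 hq0) hq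
    refine .of_norm_bounded (hs.mul_left
      ((Real.exp (‖a * b‖ * (1 - ‖q‖)⁻¹) / ‖qPochhammerInf (a * b) q‖) *
        (Real.exp (‖c‖ * (1 - ‖q‖)⁻¹) / ‖qPochhammerInf c q‖))) fun ⟨n, m⟩ => ?_
    have hwn : ‖w n‖ ≤ (Real.exp (‖a * b‖ * (1 - ‖q‖)⁻¹) / ‖qPochhammerInf (a * b) q‖) *
        ((‖a‖ * M) ^ n * ‖q‖ ^ n.choose 2) := by
      calc ‖w n‖ = ‖(qPochhammer (a * b) q n)⁻¹‖ *
            (‖a‖ ^ n * ‖ascConvolution a b q z n‖ * ‖q‖ ^ n.choose 2) := by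
            simp only [hw, div_eq_mul_inv, norm_mul, norm_pow, norm_neg]
            ring
        _ ≤ _ := by
            rw [mul_pow]
            gcongr
            · exact norm_inv_qPochhammer_le hq hab n
            · exact hM n
    rw [norm_mul]
    refine (mul_le_mul hwn (norm_basicHypergeometricTerm_le hq hq0 hc n m) (norm_nonneg _)
      (by positivity)).trans_eq ?_
    ring
  have hrow : ∀ n, HasSum (fun m => w n * H n m)
      (w n * basicHypergeometric [] [c] q (q ^ (2 - (n : ℤ)) / a ^ 2)) := fun n =>
    (summable_basicHypergeometricTerm hq hq0 hc n).hasSum.mul_left _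
  set K := qPochhammerInf (a * z⁻¹) q * qPochhammerInf (a * z) q /
    (qPochhammerInf (a * b) q * qPochhammerInf c q) with hK
  have hcb : q / a * b = c := by rw [hcdef]; ring
  have hcol : ∀ m, HasSum (fun n => w n * H n m)
      (K * ((-(q / a)) ^ m * q ^ m.choose 2 * q⁻¹ ^ (0 * m) *
        qPochhammerInf (q / a * b * q ^ m) q * ascConvolution (q / a) b q z m)) := by
    intro m
    have h1 := (hasSum_ascConvolution_mul_inv_pow a b z hq hq0 hz m).mul_left
      ((qPochhammerInf (a * b) q)⁻¹ * ((qPochhammer c q m)⁻¹ * (qPochhammer q q m)⁻¹ *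
        (q ^ 2 / a ^ 2) ^ m * (q ^ m.choose 2 * q ^ m.choose 2)))
    rw [sum_eq_ascConvolution_dual hq hq0 ha hz] at h1
    have hv : (qPochhammerInf (a * b) q)⁻¹ * ((qPochhammer c q m)⁻¹ * (qPochhammer q q m)⁻¹ *
        (q ^ 2 / a ^ 2) ^ m * (q ^ m.choose 2 * q ^ m.choose 2)) *
        (qPochhammerInf (a * z⁻¹) q * (qPochhammerInf (a * z) q * qPochhammer q q m * (-a) ^ m *
          q⁻¹ ^ (m + 1).choose 2 * ascConvolution (q / a) b q z m)) =
        K * ((-(q / a)) ^ m * q ^ m.choose 2 * q⁻¹ ^ (0 * m) *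
          qPochhammerInf (q / a * b * q ^ m) q * ascConvolution (q / a) b q z m) := by
      have e1 := qPochhammerInf_eq_mul c hq m
      have e2 := qPochhammer_ne_zero hc m
      have e3 := qPochhammer_self_ne_zero hq m
      have e4 : qPochhammerInf (c * q ^ m) q ≠ 0 := by
        rw [e1] at hc'
        exact right_ne_zero_of_mul hc'
      rw [hK, hcb, e1, succ_choose_two, zero_mul, pow_zero, neg_pow a, neg_pow (q / a), div_pow,
        div_pow, inv_pow, pow_add]
      generalize qPochhammerInf (c * q ^ m) q = S at e4 ⊢
      field_simp
      ring
    rw [hv] at h1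
    refine h1.congr_fun fun n => ?_
    have e1 := qPochhammerInf_eq_mul (a * b) hq n
    have e2 := qPochhammer_ne_zero hab n
    have e3 : qPochhammerInf (a * b * q ^ n) q ≠ 0 := by
      rw [e1] at hab'
      exact right_ne_zero_of_mul hab'
    have e4 : (qPochhammer (a * b) q n)⁻¹ =
        (qPochhammerInf (a * b) q)⁻¹ * qPochhammerInf (a * b * q ^ n) q := by
      rw [e1]
      field_simp
    simp only [hw, hH]
    rw [basicHypergeometricTerm_eq hq0, div_eq_mul_inv _ (qPochhammer (a * b) q n), e4]
    ring
  have hdual := (hasSum_ascConvolution_mul_inv_pow (q / a) b z hq hq0 hz 0).mul_left K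
  have hval : K * (qPochhammerInf (q / a * z⁻¹) q * ∑ i ∈ Finset.range (0 + 1),
        qPochhammer (q⁻¹ ^ 0) q i * qPochhammer (b * z) q i / qPochhammer q q i *
          (q / a * z⁻¹) ^ i * qPochhammerInf (q / a * z * q⁻¹ ^ 0 * q ^ i) q) =
      qPochhammerInf (a * z⁻¹) q * qPochhammerInf (a * z) q *
          qPochhammerInf (q * z⁻¹ / a) q * qPochhammerInf (q * z / a) q /
        (qPochhammerInf (a * b) q * qPochhammerInf c q) := by
    have e1 : q / a * z⁻¹ = q * z⁻¹ / a := by ring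
    have e2 : q / a * z = q * z / a := by ring
    rw [zero_add, Finset.sum_range_one, e1, e2]
    simp only [qPochhammer_zero_right, pow_zero, mul_one, div_one, one_mul, hK]
    ring
  rw [hval] at hdual
  have hS := hsum.hasSum
  rw [(((Equiv.prodComm ℕ ℕ).hasSum_iff.2 hS).prod_fiberwise hcol).unique hdual] at hS
  exact hS.prod_fiberwise hrow

theorem mainTheorem3 (q a b θ : ℝ) (hq0 : 0 < q) (hq1 : q < 1)
    (ha0 : 0 < |a|) (ha1 : |a| < 1) (hb : |b| < 1)
    (hab : ∀ k : ℕ, q * b / a * q ^ k ≠ 1)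
    (hθ : θ ∈ Set.Ioo 0 Real.pi) :
    (∀ n : ℕ, Summable
      (basicHypergeometricTerm [] [(q : ℂ) * b / a] q ((q : ℂ) ^ (2 - (n : ℤ)) / (a : ℂ) ^ 2))) ∧
    HasSum
      (fun n : ℕ =>
        (-(a : ℂ)) ^ n * (q : ℂ) ^ (n * (n - 1) / 2) /
            (qPochhammer q q n * qPochhammer ((a : ℂ) * b) q n) *
          basicHypergeometric [] [(q : ℂ) * b / a] q ((q : ℂ) ^ (2 - (n : ℤ)) / (a : ℂ) ^ 2) *
          (alSalamChihara a b q (Real.cos θ) n : ℂ))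
      (qPochhammerInf (a * Complex.exp (-(Complex.I * θ))) q *
          qPochhammerInf (a * Complex.exp (Complex.I * θ)) q *
          qPochhammerInf (q * Complex.exp (-(Complex.I * θ)) / a) q *
          qPochhammerInf (q * Complex.exp (Complex.I * θ) / a) q /
        (qPochhammerInf ((a : ℂ) * b) q * qPochhammerInf ((q : ℂ) * b / a) q)) := by
  have hq : ‖(q : ℂ)‖ < 1 := by rwa [Complex.norm_real, Real.norm_of_nonneg hq0.le]
  have hq0' : (q : ℂ) ≠ 0 := by exact_mod_cast hq0.ne'
  have ha : (a : ℂ) ≠ 0 := by exact_mod_cast abs_pos.1 ha0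
  have hab' : ∀ k : ℕ, (a : ℂ) * b * (q : ℂ) ^ k ≠ 1 := by
    refine mul_pow_ne_one_of_norm_lt_one ?_ hq
    rw [norm_mul, Complex.norm_real, Complex.norm_real, Real.norm_eq_abs, Real.norm_eq_abs]
    nlinarith [abs_nonneg b]
  have hc : ∀ k : ℕ, (q : ℂ) * b / a * (q : ℂ) ^ k ≠ 1 := fun k => by exact_mod_cast hab k
  refine ⟨fun n => summable_basicHypergeometricTerm hq hq0' hc n, ?_⟩
  set z := Complex.exp (Complex.I * θ) with hz
  have hz0 : z ≠ 0 := Complex.exp_ne_zero _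
  have hzi : Complex.exp (-(Complex.I * θ)) = z⁻¹ := Complex.exp_neg _
  have hx : z + z⁻¹ = 2 * (Real.cos θ : ℝ) := by
    rw [← hzi, hz, Complex.ofReal_cos, Complex.two_cos, mul_comm Complex.I, neg_mul]
  rw [hzi]
  refine (hasSum_ascConvolution_mul_basicHypergeometric hq hq0' ha hz0 hab' hc).congr_fun
    fun n => ?_
  have h1 := qPochhammer_self_ne_zero hq n
  rw [alSalamChihara_eq a b q _ hq0 hq1 hz0 hx n, ← Nat.choose_two_right]
  field_simp
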